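/- Let $n\ge 1$ and let $X\subset\mathbb{R}^n$ be any set (not necessarily measurable). For mutually distinct points $x,y,z\in\mathbb{R}^n$ let $r(x,y,z)\in(0,\infty]$ be their circumradius, $$r(x,y,z)=\frac{abc}{\sqrt{(a+b+c)(a+b-c)(a-b+c)(-a+b+c)}},\qquad a=|x-y|,\ b=|y-z|,\ c=|z-x|,$$ with value $\infty$ if the three points are collinear, and let the thickness of $X$ be $\Delta[X]=\inf r(u,v,w)$, the infimum being taken over all triples of mutually distinct points $u,v,w\in X$ (with $\inf\emptyset=\infty$, $1/\infty=0$, $1/0=\infty$). Let $\mathcal{H}^1$ be the one-dimensional Hausdorff (outer) measure on $\mathbb{R}^n$. Suppose that $\mathcal{H}^1(X)<\infty$ and $1/\Delta[X]<\infty$. (a) $X$ has an approximate $1$-tangent at every point $x\in\mathbb{R}^n$ (whether or not $x\in X$); that is, for every $x\in\mathbb{R}^n$ there is a unit vector $s\in\mathbb{S}^{n-1}$ such that for all $\epsilon>0$ $$\lim_{r\downarrow 0}\frac{\mathcal{H}^1\big([X\setminus C_{s,\epsilon}(x)]\cap\overline{B}_r(x)\big)}{2r}=0,$$ where $\overline{B}_r(x)$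 is the closed ball of radius $r$ about $x$ and $C_{s,\epsilon}(x)=\{y\in\mathbb{R}^n\setminus\{x\} : \min\{\measuredangle(y,x,x-s),\measuredangle(y,x,x+s)\}<\epsilon\}$ is the open double cone about $x$ in direction $s$ with opening angle $\epsilon$ ($\measuredangle(y,x,z)\in[0,\pi]$ denotes the angle at $x$). (b) If in addition $X$ is $\mathcal{H}^1$-measurable in the sense of Carathéodory, i.e. $\mathcal{H}^1(M)=\mathcal{H}^1(M\cap X)+\mathcal{H}^1(M\setminus X)$ for all $M\subset\mathbb{R}^n$, then $X$ is $1$-rectifiable, i.e. there are countably many Lipschitz maps $f_i:\mathbb{R}\to\mathbb{R}^n$, $i\in\mathbb{N}$, with $\mathcal{H}^1\big(X\setminus\bigcup_i f_i(\mathbb{R})\big)=0$. -/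

import Mathlib

open MeasureTheory Set Filter Topology
open scoped ENNReal NNReal

noncomputable section

namespace MengerCurvature

/-- The circumradius of three mutually distinct points `x, y, z` of a metric space, as an extended
nonnegative number. For distinct points the numerator is positive, so a degenerate (collinear)
triple gets the value `∞`. It is only ever used on triples of mutually distinct points. -/
def circumradius {E : Type*} [MetricSpace E] (x y z : E) : ℝ≥0∞ :=
  let a := dist x y
  let b := dist y z
  let c := dist z x
  ENNReal.ofReal (a * b * c) /
    ENNReal.ofReal (Real.sqrt ((a + b + c) * (a + b - c) * (a - b + c) * (-a + b + c)))

/-- The thickness `Δ[X]`: the infimum of the circumradii of all triples of mutually distinct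
points of `X`. It is `∞` if there are no such triples. -/
def thickness {E : Type*} [MetricSpace E] (X : Set E) : ℝ≥0∞ :=
  ⨅ (u ∈ X) (v ∈ X) (w ∈ X) (_ : u ≠ v) (_ : v ≠ w) (_ : w ≠ u), circumradius u v w

/-- `C_{s,ε}(x)`: the open double cone centred at `x` in direction `s` with opening angle `ε`;
the centre `x` itself does not belong to it. -/
def doubleCone {n : ℕ} (s : EuclideanSpace ℝ (Fin n)) (ε : ℝ) (x : EuclideanSpace ℝ (Fin n)) :
    Set (EuclideanSpace ℝ (Fin n)) :=
  {y | y ≠ x ∧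
    min (EuclideanGeometry.angle y x (x - s)) (EuclideanGeometry.angle y x (x + s)) < ε}

/-- The set `A` has `α`-dimensional Hausdorff density `θ` at `x`, i.e. the limit of
`H^α(A ∩ closedBall x r) / (2r)^α` as `r ↓ 0` exists and equals `θ`. For sets that are not
measurable, Mathlib's `μH[α]` is the Hausdorff outer measure. -/
def HasHausdorffDensity {E : Type*} [MetricSpace E] [MeasurableSpace E] [BorelSpace E]
    (α : ℝ) (A : Set E) (x : E) (θ : ℝ≥0∞) : Prop :=
  Tendsto (fun r : ℝ => μH[α] (A ∩ Metric.closedBall x r) / ENNReal.ofReal ((2 * r) ^ α))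
    (𝓝[>] (0 : ℝ)) (𝓝 θ)

/-- `X` has a (strong) approximate `α`-tangent at `x`. -/
def HasApproximateTangent {n : ℕ} (α : ℝ) (X : Set (EuclideanSpace ℝ (Fin n)))
    (x : EuclideanSpace ℝ (Fin n)) : Prop :=
  ∃ s : EuclideanSpace ℝ (Fin n), ‖s‖ = 1 ∧
    ∀ ε : ℝ, 0 < ε → HasHausdorffDensity α (X \ doubleCone s ε x) x 0

/-- `X` is `1`-rectifiable: up to an `H^1`-null set it is covered by countably many Lipschitz
images of the real line. -/
def IsOneRectifiable {E : Type*} [MetricSpace E] [MeasurableSpace E] [BorelSpace E]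
    (X : Set E) : Prop :=
  ∃ f : ℕ → ℝ → E, (∀ i, ∃ K : ℝ≥0, LipschitzWith K (f i)) ∧ μH[1] (X \ ⋃ i, range (f i)) = 0

end MengerCurvature

end

/-!
In a triangle with circumradius `R`, the sine of the angle at `x` is `|y - z| / (2R)`. A set `X` with
positive thickness therefore satisfies, for some `Δ > 0` and all `x, y, z ∈ X`,

  `4 Δ² (‖y - x‖² ‖z - x‖² - ⟪y - x, z - x⟫²) ≤ (‖y - x‖ ‖z - x‖ ‖y - z‖)²`,

an inequality that is closed and also holds for degenerate triples, so that it passes to the closure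
of `X` (`HasSineBound.closure`).

It says that the lines from a point `x` to two points of `X` near `x` are nearly parallel. If `x` is an
accumulation point of `X`, the unit directions from `x` to points of `X` thus have a limit `s` up to
sign, and for every `ε > 0` all points of `X \ {x}` close to `x` lie in the double cone
`C_{s,ε}(x)` (`HasSineBound.exists_direction`). What remains outside the cone is at most the point
`x`, whose length is zero. If `x` is not an accumulation point, any direction will do.

Likewise all secants of a part of `X` of diameter at most `Δ` make an angle of at most `π / 3` with
one fixed line (`HasSineBound.half_le_abs_inner`). The orthogonal projection of that part to the line
has a Lipschitz inverse, so the part is contained in a Lipschitz image of `ℝ`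
(`HasSineBound.exists_lipschitz_cover`), and countably many such parts exhaust `X`.
-/

open scoped RealInnerProductSpace

namespace MengerCurvature

/-! ### The sine bound -/

section SineBound

variable {E : Type*} [NormedAddCommGroup E] [InnerProductSpace ℝ E]

/-- The law of sines for triangles of circumradius at least `Δ`, with denominators cleared and
squared: the sine of the angle at `x` is at most `‖y - z‖ / (2 Δ)` for all `x, y, z ∈ X`. The points
are not required to be distinct. -/
def HasSineBound (Δ : ℝ) (X : Set E) : Prop :=
  ∀ x ∈ X, ∀ y ∈ X, ∀ z ∈ X,
    4 * Δ ^ 2 * (‖y - x‖ ^ 2 * ‖z - x‖ ^ 2 - ⟪y - x, z - x⟫ ^ 2) ≤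
      (‖y - x‖ * ‖z - x‖ * ‖y - z‖) ^ 2

/-- Heron's formula: the product under the square root is sixteen times the squared area. -/
theorem heron_eq_inner (x y z : E) :
    (dist x y + dist y z + dist z x) * (dist x y + dist y z - dist z x) *
        (dist x y - dist y z + dist z x) * (-dist x y + dist y z + dist z x) =
      4 * (‖y - x‖ ^ 2 * ‖z - x‖ ^ 2 - ⟪y - x, z - x⟫ ^ 2) := by
  have h : dist y z ^ 2 = ‖y - x‖ ^ 2 - 2 * ⟪y - x, z - x⟫ + ‖z - x‖ ^ 2 := by
    rw [dist_eq_norm, ← norm_sub_sq_real, sub_sub_sub_cancel_right]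
  rw [dist_comm x y, dist_eq_norm y x, dist_eq_norm z x]
  have h2 : ⟪y - x, z - x⟫ = (‖y - x‖ ^ 2 + ‖z - x‖ ^ 2 - dist y z ^ 2) / 2 := by
    rw [h]; ring
  rw [h2]
  ring

theorem exists_hasSineBound {X : Set E} (h : 1 / thickness X < ∞) :
    ∃ Δ : ℝ, 0 < Δ ∧ HasSineBound Δ X := by
  have h0 : 0 < thickness X := by
    rw [pos_iff_ne_zero]
    intro h0
    simp [h0] at h
  obtain ⟨Δ, hΔ0, hΔ⟩ := ENNReal.lt_iff_exists_nnreal_btwn.1 h0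
  refine ⟨Δ, by exact_mod_cast hΔ0, fun x hx y hy z hz => ?_⟩
  by_cases hxy : x = y
  · simp [hxy]
  by_cases hzx : z = x
  · simp [hzx]
  by_cases hyz : y = z
  · simp [hyz, sq]
  have hr : (Δ : ℝ≥0∞) ≤ circumradius x y z :=
    hΔ.le.trans <| (iInf₂_le x hx).trans <| (iInf₂_le y hy).trans <| (iInf₂_le z hz).trans <|
      (iInf_le _ hxy).trans <| (iInf_le _ hyz).trans <| iInf_le _ hzx
  unfold circumradius at hr
  have hr' := ENNReal.mul_le_of_le_div hr
  rw [← ENNReal.ofReal_coe_nnreal, ← ENNReal.ofReal_mul Δ.coe_nonneg,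
    ENNReal.ofReal_le_ofReal_iff (by positivity), heron_eq_inner] at hr'
  have hS : 0 ≤ 4 * (‖y - x‖ ^ 2 * ‖z - x‖ ^ 2 - ⟪y - x, z - x⟫ ^ 2) := by
    have := sq_le_sq' (neg_le_of_abs_le (abs_real_inner_le_norm (y - x) (z - x)))
      (real_inner_le_norm (y - x) (z - x))
    rw [mul_pow] at this
    linarith
  have hsq := pow_le_pow_left₀ (by positivity) hr' 2
  rw [mul_pow, Real.sq_sqrt hS, dist_comm x y, dist_eq_norm, dist_eq_norm, dist_eq_norm] at hsq
  linarith

variable {Δ : ℝ} {X : Set E}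

theorem HasSineBound.mono {Y : Set E} (h : HasSineBound Δ X) (hY : Y ⊆ X) : HasSineBound Δ Y :=
  fun x hx y hy z hz => h x (hY hx) y (hY hy) z (hY hz)

theorem HasSineBound.closure (h : HasSineBound Δ X) : HasSineBound Δ (_root_.closure X) := by
  have hsub : _root_.closure (X ×ˢ X ×ˢ X) ⊆ {t : E × E × E |
      4 * Δ ^ 2 * (‖t.2.1 - t.1‖ ^ 2 * ‖t.2.2 - t.1‖ ^ 2 - ⟪t.2.1 - t.1, t.2.2 - t.1⟫ ^ 2) ≤
        (‖t.2.1 - t.1‖ * ‖t.2.2 - t.1‖ * ‖t.2.1 - t.2.2‖) ^ 2} :=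
    closure_minimal (fun t ht => h _ ht.1 _ ht.2.1 _ ht.2.2)
      (isClosed_le (by fun_prop) (by fun_prop))
  rw [closure_prod_eq, closure_prod_eq] at hsub
  exact fun x hx y hy z hz => hsub (show (x, y, z) ∈ _ from ⟨hx, hy, hz⟩)

/-! ### The tangent direction at an accumulation point -/

/-- The sine bound in terms of the unit directions from `x` to `y` and to `z`. -/
theorem HasSineBound.one_sub_sq_inner_le (h : HasSineBound Δ X) {x y z : E} (hx : x ∈ X)
    (hy : y ∈ X) (hz : z ∈ X) (hyx : y ≠ x) (hzx : z ≠ x) :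
    4 * Δ ^ 2 * (1 - ⟪‖y - x‖⁻¹ • (y - x), ‖z - x‖⁻¹ • (z - x)⟫ ^ 2) ≤ ‖y - z‖ ^ 2 := by
  have hy0 : 0 < ‖y - x‖ := norm_pos_iff.2 (sub_ne_zero.2 hyx)
  have hz0 : 0 < ‖z - x‖ := norm_pos_iff.2 (sub_ne_zero.2 hzx)
  have key := h x hx y hy z hz
  rw [real_inner_smul_left, real_inner_smul_right]
  have hpos : 0 < ‖y - x‖ ^ 2 * ‖z - x‖ ^ 2 := by positivity
  refine le_of_mul_le_mul_left ?_ hpos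
  calc _ = 4 * Δ ^ 2 * (‖y - x‖ ^ 2 * ‖z - x‖ ^ 2 - ⟪y - x, z - x⟫ ^ 2) := by
        field_simp
    _ ≤ _ := key
    _ = _ := by ring

theorem HasSineBound.exists_direction [ProperSpace E] (h : HasSineBound Δ X) {x : E}
    (hx : AccPt x (𝓟 X)) :
    ∃ s : E, ‖s‖ = 1 ∧ ∀ y ∈ X, y ≠ x →
      4 * Δ ^ 2 * (1 - ⟪‖y - x‖⁻¹ • (y - x), s⟫ ^ 2) ≤ ‖y - x‖ ^ 2 := by
  have : NeBot (𝓝[≠] x ⊓ 𝓟 X) := hx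
  set U := Ultrafilter.of (𝓝[≠] x ⊓ 𝓟 X)
  have hU : (U : Filter E) ≤ 𝓝[≠] x ⊓ 𝓟 X := Ultrafilter.of_le _
  have hUx : Tendsto id (U : Filter E) (𝓝 x) :=
    hU.trans (inf_le_left.trans nhdsWithin_le_nhds)
  have hne : ∀ᶠ z in (U : Filter E), z ≠ x := (hU.trans inf_le_left) self_mem_nhdsWithin
  have hmem : ∀ᶠ z in (U : Filter E), z ∈ X := (hU.trans inf_le_right) (mem_principal_self X)
  set dir : E → E := fun z => ‖z - x‖⁻¹ • (z - x)
  obtain ⟨s, hs, hlim⟩ := (isCompact_sphere (0 : E) 1).ultrafilter_le_nhds (U.map dir) (by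
    rw [Ultrafilter.coe_map, le_principal_iff, mem_map]
    filter_upwards [hne] with z hz
    have : ‖z - x‖ ≠ 0 := norm_ne_zero_iff.2 (sub_ne_zero.2 hz)
    simp [dir, norm_smul, this])
  have hdir : Tendsto dir (U : Filter E) (𝓝 s) := hlim
  refine ⟨s, by simpa using hs, fun y hy hyx => ?_⟩
  refine le_of_tendsto_of_tendsto (b := (U : Filter E))
    (f := fun z => 4 * Δ ^ 2 * (1 - ⟪dir y, dir z⟫ ^ 2)) (g := fun z => ‖y - z‖ ^ 2) ?_ ?_ ?_
  · exact (((tendsto_const_nhds.inner hdir).pow 2).const_sub 1).const_mul _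
  · exact ((hUx.const_sub y).norm.pow 2)
  · filter_upwards [hne, hmem] with z hz hzX
    have hxc : x ∈ _root_.closure X := mem_closure_iff_clusterPt.2 hx.clusterPt
    exact h.closure.one_sub_sq_inner_le hxc (subset_closure hy) (subset_closure hzX) hyx hz

/-! ### Covering by Lipschitz curves -/

/-- If `p` and `e` both make an angle of at most `π / 6` with the line through `q`, they make an
angle of at most `π / 3` with each other, up to sign. -/
theorem half_le_abs_inner_of_inner_sq {p q e : E} (hq : q ≠ 0)
    (hp : 3 / 4 * (‖p‖ ^ 2 * ‖q‖ ^ 2) ≤ ⟪p, q⟫ ^ 2)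
    (he : 3 / 4 * (‖e‖ ^ 2 * ‖q‖ ^ 2) ≤ ⟪e, q⟫ ^ 2) :
    1 / 2 * (‖p‖ * ‖e‖) ≤ |⟪p, e⟫| := by
  have hq0 : 0 < ‖q‖ := norm_pos_iff.2 hq
  -- The components of `p` and `e` orthogonal to `q`, scaled by `‖q‖ ^ 2`, are at most half as long
  -- as they could be.
  have hperp : ∀ v : E, 3 / 4 * (‖v‖ ^ 2 * ‖q‖ ^ 2) ≤ ⟪v, q⟫ ^ 2 →
      ‖‖q‖ ^ 2 • v - ⟪v, q⟫ • q‖ ≤ 1 / 2 * (‖q‖ ^ 2 * ‖v‖) := by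
    intro v hv
    refine le_of_sq_le_sq ?_ (by positivity)
    rw [norm_sub_sq_real, norm_smul, norm_smul, real_inner_smul_left, real_inner_smul_right]
    simp only [mul_pow, Real.norm_eq_abs, sq_abs]
    nlinarith [mul_le_mul_of_nonneg_left hv (sq_nonneg ‖q‖)]
  have hin : ⟪‖q‖ ^ 2 • p - ⟪p, q⟫ • q, ‖q‖ ^ 2 • e - ⟪e, q⟫ • q⟫ =
      ‖q‖ ^ 2 * (‖q‖ ^ 2 * ⟪p, e⟫ - ⟪p, q⟫ * ⟪e, q⟫) := by
    simp only [inner_sub_left, inner_sub_right, real_inner_smul_left, real_inner_smul_right,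
      real_inner_self_eq_norm_sq, real_inner_comm e q]
    ring
  have hcs := abs_real_inner_le_norm (‖q‖ ^ 2 • p - ⟪p, q⟫ • q) (‖q‖ ^ 2 • e - ⟪e, q⟫ • q)
  rw [hin, abs_mul, abs_of_nonneg (sq_nonneg ‖q‖)] at hcs
  have hle := hcs.trans (mul_le_mul (hperp p hp) (hperp e he) (norm_nonneg _) (by positivity))
  have hle' : |‖q‖ ^ 2 * ⟪p, e⟫ - ⟪p, q⟫ * ⟪e, q⟫| ≤ ‖q‖ ^ 2 * (1 / 4 * (‖p‖ * ‖e‖)) := by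
    refine le_of_mul_le_mul_left (hle.trans (le_of_eq ?_)) (pow_pos hq0 2)
    ring
  have hprod : 3 / 4 * (‖p‖ * ‖e‖) * ‖q‖ ^ 2 ≤ |⟪p, q⟫ * ⟪e, q⟫| := by
    refine le_of_sq_le_sq ?_ (abs_nonneg _)
    rw [sq_abs, mul_pow ⟪p, q⟫]
    refine (le_of_eq ?_).trans (mul_le_mul hp he (by positivity) (by positivity))
    ring
  have htri : |⟪p, q⟫ * ⟪e, q⟫| ≤
      |‖q‖ ^ 2 * ⟪p, e⟫| + |‖q‖ ^ 2 * ⟪p, e⟫ - ⟪p, q⟫ * ⟪e, q⟫| := by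
    have := abs_sub (‖q‖ ^ 2 * ⟪p, e⟫) (‖q‖ ^ 2 * ⟪p, e⟫ - ⟪p, q⟫ * ⟪e, q⟫)
    rwa [sub_sub_cancel] at this
  rw [abs_mul (‖q‖ ^ 2), abs_of_nonneg (sq_nonneg ‖q‖)] at htri
  refine le_of_mul_le_mul_left ?_ (pow_pos hq0 2)
  linarith

/-- In a set of diameter at most `Δ` that satisfies the sine bound, all angles of triangles are
within `π / 6` of `0` or `π`. -/
theorem HasSineBound.inner_sq_ge (h : HasSineBound Δ X) (hΔ : 0 < Δ)
    (hd : ∀ y ∈ X, ∀ z ∈ X, dist y z ≤ Δ) {x y z : E} (hx : x ∈ X) (hy : y ∈ X) (hz : z ∈ X) :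
    3 / 4 * (‖y - x‖ ^ 2 * ‖z - x‖ ^ 2) ≤ ⟪y - x, z - x⟫ ^ 2 := by
  have key := h x hx y hy z hz
  have hyz : ‖y - z‖ ^ 2 ≤ Δ ^ 2 :=
    pow_le_pow_left₀ (norm_nonneg _) (by simpa [dist_eq_norm] using hd y hy z hz) 2
  have := mul_le_mul_of_nonneg_left hyz
    (by positivity : 0 ≤ ‖y - x‖ ^ 2 * ‖z - x‖ ^ 2)
  refine le_of_mul_le_mul_left ?_ (by positivity : 0 < 4 * Δ ^ 2)
  rw [mul_pow, mul_pow] at key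
  linarith

/-- All secants of a set of diameter at most `Δ` that satisfies the sine bound are within `π / 3` of
the direction of any one of them. -/
theorem HasSineBound.half_le_abs_inner (h : HasSineBound Δ X) (hΔ : 0 < Δ)
    (hd : ∀ y ∈ X, ∀ z ∈ X, dist y z ≤ Δ) {a b y z : E} (ha : a ∈ X) (hb : b ∈ X) (hy : y ∈ X)
    (hz : z ∈ X) : 1 / 2 * (‖y - z‖ * ‖b - a‖) ≤ |⟪y - z, b - a⟫| := by
  -- The secant through `z` and `a` shares an endpoint with each of the two given secants.
  by_cases hza : z = a
  · subst hza
    have := h.inner_sq_ge hΔ hd hz hy hb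
    refine le_of_sq_le_sq ?_ (abs_nonneg _)
    rw [sq_abs]
    nlinarith [sq_nonneg (‖y - z‖ * ‖b - z‖)]
  · refine half_le_abs_inner_of_inner_sq (sub_ne_zero.2 (Ne.symm hza))
      (h.inner_sq_ge hΔ hd hz hy ha) ?_
    rw [← neg_sub z a, norm_neg, inner_neg_right, neg_sq]
    exact h.inner_sq_ge hΔ hd ha hb hz

theorem HasSineBound.exists_lipschitz_cover [FiniteDimensional ℝ E] (h : HasSineBound Δ X)
    (hΔ : 0 < Δ) (hd : ∀ y ∈ X, ∀ z ∈ X, dist y z ≤ Δ) :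
    ∃ f : ℝ → E, (∃ K : ℝ≥0, LipschitzWith K f) ∧ X ⊆ range f := by
  rcases X.subsingleton_or_nontrivial with hX | ⟨a, ha, b, hb, hab⟩
  · rcases hX.eq_empty_or_singleton with rfl | ⟨c, rfl⟩
    · exact ⟨fun _ => 0, ⟨0, LipschitzWith.const 0⟩, empty_subset _⟩
    · exact ⟨fun _ => c, ⟨0, LipschitzWith.const c⟩, by simp⟩
  have hpos : 0 < ‖b - a‖ := norm_pos_iff.2 (sub_ne_zero.2 hab.symm)
  set g : E → ℝ := fun y => ⟪y, b - a⟫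
  have hg : ∀ y ∈ X, ∀ z ∈ X, dist y z ≤ 2 / ‖b - a‖ * dist (g y) (g z) := by
    intro y hy z hz
    have := h.half_le_abs_inner hΔ hd ha hb hy hz
    rw [dist_eq_norm, Real.dist_eq, ← inner_sub_left, div_mul_eq_mul_div, le_div_iff₀ hpos]
    linarith
  have hinj : InjOn g X := fun y hy z hz hyz => by
    have := hg y hy z hz
    rw [hyz, dist_self, mul_zero] at this
    exact dist_le_zero.1 this
  have hlip : LipschitzOnWith (2 / ‖b - a‖).toNNReal (Function.invFunOn g X) (g '' X) := by
    refine LipschitzOnWith.of_dist_le_mul ?_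
    rintro _ ⟨y, hy, rfl⟩ _ ⟨z, hz, rfl⟩
    rw [hinj.leftInvOn_invFunOn hy, hinj.leftInvOn_invFunOn hz,
      Real.coe_toNNReal _ (by positivity)]
    exact hg y hy z hz
  obtain ⟨f, hf, heq⟩ := hlip.extend_finite_dimension
  exact ⟨f, ⟨_, hf⟩, fun y hy => ⟨g y,
    (heq (mem_image_of_mem g hy)).symm.trans (hinj.leftInvOn_invFunOn hy)⟩⟩

theorem HasSineBound.isOneRectifiable [FiniteDimensional ℝ E] [MeasurableSpace E] [BorelSpace E]
    (h : HasSineBound Δ X) (hΔ : 0 < Δ) : IsOneRectifiable X := by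
  have : ProperSpace E := FiniteDimensional.proper_real E
  have hcov (i : ℕ) := (h.mono (inter_subset_left (t :=
    Metric.ball (TopologicalSpace.denseSeq E i) (Δ / 2)))).exists_lipschitz_cover hΔ
      (fun y hy z hz => by
        have hyi := Metric.mem_ball.1 hy.2
        have hzi := Metric.mem_ball.1 hz.2
        linarith [dist_triangle_right y z (TopologicalSpace.denseSeq E i)])
  choose f hf hsub using hcov
  refine ⟨f, hf, ?_⟩
  rw [sdiff_eq_empty.2, measure_empty]
  intro x hx
  obtain ⟨i, hi⟩ := (TopologicalSpace.denseRange_denseSeq E).exists_dist_lt x (half_pos hΔ)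
  exact mem_iUnion.2 ⟨i, hsub i ⟨hx, Metric.mem_ball.2 hi⟩⟩

end SineBound

/-! ### Approximate tangents -/

section Tangent

variable {n : ℕ} {X : Set (EuclideanSpace ℝ (Fin n))} {x s : EuclideanSpace ℝ (Fin n)}

/-- The smaller of the angles of `y - x` with `s` and `-s` is the arccosine of the absolute value
of either cosine. -/
theorem mem_doubleCone_of_arccos_lt {ε : ℝ} {y : EuclideanSpace ℝ (Fin n)} (hs : ‖s‖ = 1)
    (hyx : y ≠ x) (h : Real.arccos |⟪‖y - x‖⁻¹ • (y - x), s⟫| < ε) : y ∈ doubleCone s ε x := by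
  have hcos : ⟪‖y - x‖⁻¹ • (y - x), s⟫ = ⟪y - x, s⟫ / (‖y - x‖ * ‖s‖) := by
    rw [real_inner_smul_left, hs, mul_one, inv_mul_eq_div]
  refine ⟨hyx, min_lt_iff.2 ?_⟩
  simp only [EuclideanGeometry.angle, vsub_eq_sub, sub_sub_cancel_left, add_sub_cancel_left,
    InnerProductGeometry.angle, inner_neg_right, norm_neg]
  rw [hcos] at h
  rcases abs_cases (⟪y - x, s⟫ / (‖y - x‖ * ‖s‖)) with ⟨h', -⟩ | ⟨h', -⟩
  · exact Or.inr (by rwa [h'] at h)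
  · exact Or.inl (by rwa [h', ← neg_div] at h)

theorem hasHausdorffDensity_zero_of_eventually {E : Type*} [MetricSpace E] [MeasurableSpace E]
    [BorelSpace E] {A : Set E} {x : E} (h : ∀ᶠ y in 𝓝 x, y ∈ A → y = x) :
    HasHausdorffDensity 1 A x 0 := by
  obtain ⟨δ, hδ, hball⟩ := Metric.eventually_nhds_iff.1 h
  refine tendsto_const_nhds.congr' ?_
  filter_upwards [Ioo_mem_nhdsGT hδ] with r hr
  have hsub : A ∩ Metric.closedBall x r ⊆ {x} := fun y hy =>
    hball ((Metric.mem_closedBall.1 hy.2).trans_lt hr.2) hy.1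
  have : NullSingletonClass (μH[1] : Measure E) := Measure.nullSingletonClass_hausdorff E one_pos
  rw [measure_mono_null hsub (measure_singleton x), ENNReal.zero_div]

theorem HasSineBound.hasApproximateTangent {Δ : ℝ} (h : HasSineBound Δ X) (hΔ : 0 < Δ)
    (hn : 1 ≤ n) (x : EuclideanSpace ℝ (Fin n)) : HasApproximateTangent 1 X x := by
  by_cases hx : AccPt x (𝓟 X)
  · obtain ⟨s, hs, hdir⟩ := h.exists_direction hx
    refine ⟨s, hs, fun ε hε => hasHausdorffDensity_zero_of_eventually ?_⟩
    have hlim : Tendsto (fun y => Real.arccos (Real.sqrt (1 - ‖y - x‖ ^ 2 / (4 * Δ ^ 2))))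
        (𝓝 x) (𝓝 0) := by
      have hc : Continuous fun y : EuclideanSpace ℝ (Fin n) =>
          Real.arccos (Real.sqrt (1 - ‖y - x‖ ^ 2 / (4 * Δ ^ 2))) :=
        Real.continuous_arccos.comp (by fun_prop)
      simpa using hc.tendsto x
    filter_upwards [hlim.eventually (gt_mem_nhds hε)] with y hy hyX
    by_contra hyx
    refine hyX.2 (mem_doubleCone_of_arccos_lt hs hyx ((Real.antitone_arccos ?_).trans_lt hy))
    refine Real.sqrt_le_iff.2 ⟨abs_nonneg _, ?_⟩
    have := hdir y hyX.1 hyx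
    rw [← le_div_iff₀' (by positivity)] at this
    rw [sq_abs]
    linarith
  · have : Nonempty (Fin n) := ⟨⟨0, hn⟩⟩
    obtain ⟨s, hs⟩ := exists_norm_eq (EuclideanSpace ℝ (Fin n)) zero_le_one
    refine ⟨s, hs, fun ε _ => hasHausdorffDensity_zero_of_eventually ?_⟩
    rw [accPt_iff_frequently, not_frequently] at hx
    filter_upwards [hx] with y hy hyX
    by_contra hyx
    exact hy ⟨hyx, hyX.1⟩

end Tangent

end MengerCurvature

theorem mainTheorem6 (n : ℕ) (hn : 1 ≤ n) (X : Set (EuclideanSpace ℝ (Fin n)))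
    (hfin : μH[1] X < ∞) (hthick : 1 / MengerCurvature.thickness X < ∞) :
    (∀ x : EuclideanSpace ℝ (Fin n), MengerCurvature.HasApproximateTangent 1 X x) ∧
      ((μH[1] : Measure (EuclideanSpace ℝ (Fin n))).toOuterMeasure.IsCaratheodory X →
        MengerCurvature.IsOneRectifiable X) := by
  obtain ⟨Δ, hΔ, h⟩ := MengerCurvature.exists_hasSineBound hthick
  exact ⟨h.hasApproximateTangent hΔ hn, fun _ => h.isOneRectifiable hΔ⟩
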